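/- All vector spaces are over $\mathbb C$. Let $(V,Y,\mathbf 1)$ be an $\mathbb N$-graded vertex algebra, that is, a vertex algebra $V=\coprod_{n\in\mathbb Z}V_{(n)}$ with $V_{(n)}=0$ for $n<0$ and, for $d$ acting on $V_{(n)}$ as multiplication by $n$, $[d,Y(u,x)]=x\frac{d}{dx}Y(u,x)+Y(du,x)$ for all $u\in V$. Write $Y(u,x)=\sum_{n\in\mathbb Z}u_nx^{-n-1}$, and $\operatorname{wt}u=n$ for $u\in V_{(n)}$. **Weak modules.** An $\mathbb N$-gradable weak $V$-module is a module $(W,Y_W)$ for the vertex algebra $V$ (lower truncation, $Y_W(\mathbf 1,x)=1_W$, Jacobi identity) with a decomposition $W=\coprod_{n\in\mathbb N}W_{(n)}$ such that, for $u\in V_{(m)}$, the component $u_n$ of $Y_W(u,x)$ maps $W_{(k)}$ to $W_{(k+m-n-1)}$ (with $W_{(j)}=0$ for $j<0$). Morphisms are the linear maps $g$ with $g(Y_{W_1}(u,x)w)=Y_{W_2}(u,x)g(w)$ for all $u\in V$, $w\in W_1$. **Zhu's algebra.** For $n\in\mathbb Z$, homogeneous $u$ and $v\in V$ put $R_n(u,v)=\sum_{i=0}^{\operatorname{wt}u}\binom{\operatorname{wt}u}{i}u_{n+i}v$,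 extended linearly in $u$; let $O(V)$ be the span of all $R_n(u,v)$ with $n\le-2$, and $A(V)=V/O(V)$ with product induced by $u*v=R_{-1}(u,v)$ and identity $\mathbf 1+O(V)$. An $A(V)$-module is a vector space $M$ with a linear map $\rho:A(V)\to\operatorname{End}M$ such that $\rho(\mathbf 1+O(V))=1_M$ and $\rho(u*v+O(V))=\rho(u+O(V))\rho(v+O(V))$ for all $u,v\in V$; morphisms are the linear maps commuting with the actions. **The space $S(M)$.** Let $T=T(V\otimes\mathbb C[t,t^{-1}])$ be the tensor algebra, write $u(m)=u\otimes t^m$, and let $o_t(u)=u(\operatorname{wt}u-1)$ for homogeneous $u$, extended linearly. For an $A(V)$-module $(M,\rho)$, grade $T\otimes M$ by giving $u_1(m_1)\cdots u_r(m_r)w$ ($u_i$ homogeneous, $w\in M$) the degree $\sum_i(\operatorname{wt}u_i-m_i-1)$. Let $\mathcal I\subset T\otimes M$ be the $T$-submodule generated by * $u(m)w$, for homogeneous $u\in V$ and $w\in T\otimes M$ with $\operatorname{wt}u-m-1+\deg w<0$; * $o_t(u)w-\rho(u+O(V))w$, for $u\in V$ and $w\in M$; * for homogeneous $u,v\in V$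 and $w\in T\otimes M$, and $p,q\in\mathbb Z$ with $\operatorname{wt}v+\deg w>q$ and $(\operatorname{wt}u-p-1)+(\operatorname{wt}v-q-1)+\deg w\ge0$, $$u(p)v(q)w-\sum_{i=0}^{\operatorname{wt}v+\deg w-q-1}\ \sum_{j=0}^{\operatorname{wt}u+\deg w}\binom{p-\operatorname{wt}u-\deg w}{i}\binom{\operatorname{wt}u+\deg w}{j}\,(u_{p-\operatorname{wt}u-\deg w-i+j}v)(q+\operatorname{wt}u+\deg w+i-j)\,w$$ (a sum whose upper limit is negative is zero). Let $S_1(M)=(T\otimes M)/\mathcal I$ with the induced grading and $T$-action. Let $\mathcal J\subset S_1(M)$ be the $T$-submodule generated by $$\sum_{j=0}^{\operatorname{wt}u+\deg w}\binom{\operatorname{wt}u+\deg w}{j}(u_{j+m}v)(K+\operatorname{wt}u+\operatorname{wt}v-j-m-2)\,w$$ for homogeneous $u,v\in V$ and $w\in S_1(M)$, and $K,m\in\mathbb Z$ with $m\le K-2\deg w-2$. Put $S(M)=S_1(M)/\mathcal J$ with the induced grading, and define $Y_{S(M)}(u,x)w=\sum_{m\in\mathbb Z}u(m)w\,x^{-m-1}$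 for $u\in V$ and $w\in S(M)$. For a map $f:M_1\to M_2$ of $A(V)$-modules, let $S(f):S(M_1)\to S(M_2)$ be the linear map induced by $1_T\otimes f$. **Corollary 4.2.** For every $A(V)$-module $M$, $(S(M),Y_{S(M)})$ with the induced grading is an $\mathbb N$-gradable weak $V$-module; for every map $f:M_1\to M_2$ of $A(V)$-modules, $S(f)$ is a $V$-module map $S(M_1)\to S(M_2)$; and the assignments $M\mapsto(S(M),Y_{S(M)})$, $f\mapsto S(f)$ form a functor from the category of $A(V)$-modules to the category of $\mathbb N$-gradable weak $V$-modules. -/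

import Mathlib

open scoped TensorProduct
open CategoryTheory

universe u w

noncomputable section

namespace ZhuFunctor

/-! ### Vertex algebras and their modules

A map `Y : V →ₗ[ℂ] ℤ → Module.End ℂ W` encodes the vertex operator map
`Y(u, x) = ∑ n, u_n x ^ (-n-1)`, with `Y u n = u_n`. -/

/-- Lower truncation: `Y(u, x) w ∈ W((x))` for all `u` and `w`. -/
def LowerTruncated {V W : Type*} [AddCommGroup V] [Module ℂ V] [AddCommGroup W] [Module ℂ W]
    (YW : V →ₗ[ℂ] ℤ → Module.End ℂ W) : Prop :=
  ∀ (u : V) (x : W), ∃ N : ℤ, ∀ n : ℤ, N ≤ n → YW u n x = 0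

/-- The Jacobi identity for vertex operators on `W`, in components (Borcherds' identity).
All the sums are finite when `Y` and `YW` are lower truncated. -/
def JacobiIdentity {V W : Type*} [AddCommGroup V] [Module ℂ V] [AddCommGroup W] [Module ℂ W]
    (Y : V →ₗ[ℂ] ℤ → Module.End ℂ V) (YW : V →ₗ[ℂ] ℤ → Module.End ℂ W) : Prop :=
  ∀ (a b : V) (x : W) (m n k : ℤ),
    ∑ᶠ i : ℕ, Ring.choose m i • YW (Y a (n + i) b) (m + k - i) x =
      (∑ᶠ i : ℕ, ((-1 : ℤ) ^ i * Ring.choose n i) • YW a (m + n - i) (YW b (k + i) x)) -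
      ((-1 : ℂ) ^ n) •
        ∑ᶠ i : ℕ, ((-1 : ℤ) ^ i * Ring.choose n i) • YW b (n + k - i) (YW a (m + i) x)

/-- A vertex algebra structure `(Y, 𝟏)` on the complex vector space `V`. -/
structure VertexAlgebra (V : Type u) [AddCommGroup V] [Module ℂ V] where
  /-- `Y a n` is the component `a_n` of `Y(a, x) = ∑ n, a_n x ^ (-n-1)`. -/
  Y : V →ₗ[ℂ] ℤ → Module.End ℂ V
  /-- The vacuum vector. -/
  vac : V
  truncated : LowerTruncated Y
  vacuum : ∀ (n : ℤ) (a : V), Y vac n a = if n = -1 then a else 0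
  creation_nonneg : ∀ (a : V) (n : ℤ), 0 ≤ n → Y a n vac = 0
  creation : ∀ a : V, Y a (-1) vac = a
  jacobi : JacobiIdentity Y Y

/-- An `ℕ`-graded vertex algebra: a `ℤ`-graded vertex algebra `V = ∐ V_(n)` with `V_(n) = 0` for
`n < 0`. The field `homogeneous` is the component form of
`[d, Y(a, x)] = x (d/dx) Y(a, x) + Y(d a, x)`, where `d` acts on `V_(n)` as `n`. -/
structure NGradedVertexAlgebra (V : Type u) [AddCommGroup V] [Module ℂ V] extends
    VertexAlgebra V where
  /-- `gr n` is the homogeneous subspace `V_(n)`. -/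
  gr : ℤ → Submodule ℂ V
  internal : DirectSum.IsInternal gr
  gr_neg : ∀ n : ℤ, n < 0 → gr n = ⊥
  homogeneous : ∀ (k l n : ℤ) (a b : V), a ∈ gr k → b ∈ gr l → Y a n b ∈ gr (l + k - n - 1)

variable {V : Type u} [AddCommGroup V] [Module ℂ V] (A : NGradedVertexAlgebra V)

/-- `(W, YW)`, with `W = ∐ W_(n)`, is an `ℕ`-gradable weak module for `A`. The homogeneous subspaces
are indexed by all integers, those of negative degree being zero. -/
structure IsNGradableWeakModule {W : Type*} [AddCommGroup W] [Module ℂ W]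
    (YW : V →ₗ[ℂ] ℤ → Module.End ℂ W) (grW : ℤ → Submodule ℂ W) : Prop where
  truncated : LowerTruncated YW
  vacuum : ∀ (n : ℤ) (x : W), YW A.vac n x = if n = -1 then x else 0
  jacobi : JacobiIdentity A.Y YW
  internal : DirectSum.IsInternal grW
  gr_neg : ∀ n : ℤ, n < 0 → grW n = ⊥
  homogeneous : ∀ (k l n : ℤ) (a : V) (x : W), a ∈ A.gr k → x ∈ grW l →
    YW a n x ∈ grW (l + k - n - 1)

/-- The category of `ℕ`-gradable weak modules. -/
structure WeakModuleCat where
  carrier : Type w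
  [addCommGroup : AddCommGroup carrier]
  [module : Module ℂ carrier]
  Y : V →ₗ[ℂ] ℤ → Module.End ℂ carrier
  gr : ℤ → Submodule ℂ carrier
  isModule : IsNGradableWeakModule A Y gr

attribute [instance] WeakModuleCat.addCommGroup WeakModuleCat.module

/-- The condition `f (Y_{W₁}(a, x) y) = Y_{W₂}(a, x) f y` on a linear map. -/
def IsVertexMap {W₁ W₂ : Type*} [AddCommGroup W₁] [Module ℂ W₁] [AddCommGroup W₂] [Module ℂ W₂]
    (Y₁ : V →ₗ[ℂ] ℤ → Module.End ℂ W₁) (Y₂ : V →ₗ[ℂ] ℤ → Module.End ℂ W₂)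
    (f : W₁ →ₗ[ℂ] W₂) : Prop :=
  ∀ (a : V) (n : ℤ) (y : W₁), f (Y₁ a n y) = Y₂ a n (f y)

/-- Module maps. -/
@[ext]
structure WeakModuleCat.Hom {A : NGradedVertexAlgebra V} (W₁ W₂ : WeakModuleCat.{u, w} A) where
  toLin : W₁.carrier →ₗ[ℂ] W₂.carrier
  isMap : IsVertexMap W₁.Y W₂.Y toLin

instance : Category (WeakModuleCat.{u, w} A) where
  Hom W₁ W₂ := WeakModuleCat.Hom W₁ W₂
  id _ := ⟨LinearMap.id, fun _ _ _ => rfl⟩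
  comp f g := ⟨g.toLin ∘ₗ f.toLin, fun a n y => by
    rw [LinearMap.comp_apply, f.isMap, g.isMap, LinearMap.comp_apply]⟩

/-! ### Zhu's algebra and its modules -/

/-- The decomposition of a vector into its homogeneous components. -/
def decompose : V ≃ₗ[ℂ] DirectSum ℤ (fun k => A.gr k) :=
  (LinearEquiv.ofBijective (DirectSum.coeLinearMap A.gr) A.internal).symm

/-- `zhuRes A n a b = Res_x x ^ n Y((x+1) ^ L(0) a, x) b`, that is,
`∑ i ≤ k, (k choose i) a_{n+i} b` when `a` has weight `k`. -/
def zhuRes (n : ℤ) : V →ₗ[ℂ] Module.End ℂ V :=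
  (DirectSum.toModule ℂ ℤ (Module.End ℂ V) fun k =>
    ∑ i ∈ Finset.range (k.toNat + 1),
      (k.toNat.choose i) • ((LinearMap.proj (n + i)) ∘ₗ A.Y ∘ₗ (A.gr k).subtype)) ∘ₗ
  (decompose A).toLinearMap

/-- The subspace `O(V)`. -/
def zhuO : Submodule ℂ V :=
  Submodule.span ℂ {z | ∃ (n : ℤ) (a b : V), n ≤ -2 ∧ z = zhuRes A n a b}

/-- The product `a * b = Res_x x⁻¹ Y((x+1) ^ L(0) a, x) b`, which induces that of `A(V)`. -/
def zhuMul (a b : V) : V := zhuRes A (-1) a b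

/-- The underlying space `V / O(V)` of Zhu's algebra `A(V)`. -/
abbrev Zhu : Type u := V ⧸ zhuO A

/-- The class `a + O(V)` in `A(V)`. -/
abbrev toZhu (a : V) : Zhu A := (zhuO A).mkQ a

/-- The category of `A(V)`-modules: vector spaces `M` with a linear map `ρ : A(V) → End M` that
respects the product `(a + O(V)) (b + O(V)) = a * b + O(V)` and the identity `𝟏 + O(V)`. -/
structure ZhuModuleCat where
  carrier : Type w
  [addCommGroup : AddCommGroup carrier]
  [module : Module ℂ carrier]
  ρ : Zhu A →ₗ[ℂ] Module.End ℂ carrier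
  ρ_one : ρ (toZhu A A.vac) = 1
  ρ_mul : ∀ a b : V, ρ (toZhu A (zhuMul A a b)) = ρ (toZhu A a) * ρ (toZhu A b)

attribute [instance] ZhuModuleCat.addCommGroup ZhuModuleCat.module

variable {A}

/-- Maps of `A(V)`-modules. -/
@[ext]
structure ZhuModuleCat.Hom (M₁ M₂ : ZhuModuleCat.{u, w} A) where
  toLin : M₁.carrier →ₗ[ℂ] M₂.carrier
  isMap : ∀ (z : Zhu A) (x : M₁.carrier), toLin (M₁.ρ z x) = M₂.ρ z (toLin x)

instance : Category (ZhuModuleCat.{u, w} A) where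
  Hom M₁ M₂ := ZhuModuleCat.Hom M₁ M₂
  id _ := ⟨LinearMap.id, fun _ _ => rfl⟩
  comp f g := ⟨g.toLin ∘ₗ f.toLin, fun z x => by
    rw [LinearMap.comp_apply, f.isMap, g.isMap, LinearMap.comp_apply]⟩

/-! ### The graded space `T(V[t, t⁻¹]) ⊗ M` -/

/-- The tensor algebra `T(V[t, t⁻¹])` of the affinization `V[t, t⁻¹] = V ⊗ ℂ[t, t⁻¹]`. -/
abbrev TAff (V : Type u) [AddCommGroup V] [Module ℂ V] : Type u :=
  TensorAlgebra ℂ (V ⊗[ℂ] LaurentPolynomial ℂ)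

/-- The element `a(m) = a ⊗ t ^ m`, as a linear function of `a`. -/
def gen (m : ℤ) : V →ₗ[ℂ] TAff V :=
  TensorAlgebra.ι ℂ ∘ₗ
    (TensorProduct.mk ℂ V (LaurentPolynomial ℂ)).flip (LaurentPolynomial.T m)

variable (A) in
/-- `o_t(a)`: the linear extension of `a ↦ a(wt a - 1)`. -/
def oT : V →ₗ[ℂ] TAff V :=
  (DirectSum.toModule ℂ ℤ (TAff V) fun k => gen (k - 1) ∘ₗ (A.gr k).subtype) ∘ₗ
    (decompose A).toLinearMap

/-- The space `T(V[t, t⁻¹]) ⊗ M`, a left `T(V[t, t⁻¹])`-module. -/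
abbrev TM (M : ZhuModuleCat.{u, w} A) : Type (max u w) := TAff V ⊗[ℂ] M.carrier

/-- `IsMonomial M d x`: `x = a₁(m₁) ⋯ a_r(m_r) y` with `aᵢ` homogeneous and `y ∈ M`, and
`d = ∑ i, (wt aᵢ - mᵢ - 1)`. -/
inductive IsMonomial (M : ZhuModuleCat.{u, w} A) : ℤ → TM M → Prop
  | of (y : M.carrier) : IsMonomial M 0 (1 ⊗ₜ[ℂ] y)
  | act {k d : ℤ} {x : TM M} (a : V) (ha : a ∈ A.gr k) (m : ℤ) (hx : IsMonomial M d x) :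
      IsMonomial M (k - m - 1 + d) (gen m a • x)

/-- The homogeneous subspace of degree `d` of `T(V[t, t⁻¹]) ⊗ M`. -/
def grTM (M : ZhuModuleCat.{u, w} A) (d : ℤ) : Submodule ℂ (TM M) :=
  Submodule.span ℂ {x | IsMonomial M d x}

/-! ### The quotients `S₁(M)` and `S(M)` -/

variable (A) in
/-- For `a` of weight `k`, `b` of weight `l` and `x` of degree `d`, the double sum
`∑ i < l+d-q, ∑ j ≤ k+d, (p-k-d choose i) (k+d choose j) (a_{p-k-d-i+j} b)(q+k+d+i-j)`. -/
def iterateSum (k l d p q : ℤ) (a b : V) : TAff V :=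
  ∑ i ∈ Finset.range (l + d - q).toNat, ∑ j ∈ Finset.range (k + d + 1).toNat,
    (Ring.choose (p - k - d) i * Ring.choose (k + d) j) •
      gen (q + k + d + i - j) (A.Y a (p - k - d - i + j) b)

/-- The generators of the submodule `𝓘`. -/
inductive IGen (M : ZhuModuleCat.{u, w} A) : TM M → Prop
  | neg {k d : ℤ} (m : ℤ) (a : V) (x : TM M) (ha : a ∈ A.gr k) (hx : x ∈ grTM M d)
      (h : k - m - 1 + d < 0) : IGen M (gen m a • x)
  | zero (a : V) (y : M.carrier) :
      IGen M (oT A a • (1 ⊗ₜ[ℂ] y) - 1 ⊗ₜ[ℂ] M.ρ (toZhu A a) y)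
  | prod {k l d : ℤ} (p q : ℤ) (a b : V) (x : TM M) (ha : a ∈ A.gr k) (hb : b ∈ A.gr l)
      (hx : x ∈ grTM M d) (hq : q < l + d) (h : 0 ≤ (k - p - 1) + (l - q - 1) + d) :
      IGen M (gen p a • gen q b • x - iterateSum A k l d p q a b • x)

/-- The submodule `𝓘` of `T(V[t, t⁻¹]) ⊗ M`. -/
def subI (M : ZhuModuleCat.{u, w} A) : Submodule (TAff V) (TM M) :=
  Submodule.span (TAff V) {x | IGen M x}

/-- `S₁(M) = (T(V[t, t⁻¹]) ⊗ M) / 𝓘`. -/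
abbrev S₁ (M : ZhuModuleCat.{u, w} A) : Type (max u w) := TM M ⧸ subI M

/-- The homogeneous subspace of degree `d` of `S₁(M)`. -/
def grS₁ (M : ZhuModuleCat.{u, w} A) (d : ℤ) : Submodule ℂ (S₁ M) :=
  (grTM M d).map ((subI M).mkQ.restrictScalars ℂ)

variable (A) in
/-- For `a` of weight `k`, `b` of weight `l` and `x` of degree `d`, the sum
`∑ j ≤ k+d, (k+d choose j) (a_{j+m} b)(K+k+l-j-m-2)`. -/
def truncSum (k l d K m : ℤ) (a b : V) : TAff V :=
  ∑ j ∈ Finset.range (k + d + 1).toNat,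
    Ring.choose (k + d) j • gen (K + k + l - j - m - 2) (A.Y a (j + m) b)

/-- The generators of the submodule `𝓙`. -/
inductive JGen (M : ZhuModuleCat.{u, w} A) : S₁ M → Prop
  | mk {k l d : ℤ} (K m : ℤ) (a b : V) (x : S₁ M) (ha : a ∈ A.gr k) (hb : b ∈ A.gr l)
      (hx : x ∈ grS₁ M d) (h : m ≤ K - 2 * d - 2) : JGen M (truncSum A k l d K m a b • x)

/-- The submodule `𝓙` of `S₁(M)`. -/
def subJ (M : ZhuModuleCat.{u, w} A) : Submodule (TAff V) (S₁ M) :=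
  Submodule.span (TAff V) {x | JGen M x}

/-- `S(M) = S₁(M) / 𝓙`. -/
abbrev S (M : ZhuModuleCat.{u, w} A) : Type (max u w) := S₁ M ⧸ subJ M

/-- The homogeneous subspace of degree `d` of `S(M)`. -/
def grS (M : ZhuModuleCat.{u, w} A) (d : ℤ) : Submodule ℂ (S M) :=
  (grS₁ M d).map ((subJ M).mkQ.restrictScalars ℂ)

/-- The vertex operator map `Y_{S(M)}(a, x) = ∑ m, a(m) x ^ (-m-1)` on `S(M)`. -/
def YS (M : ZhuModuleCat.{u, w} A) : V →ₗ[ℂ] ℤ → Module.End ℂ (S M) :=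
  LinearMap.pi fun m => (Algebra.lsmul ℂ ℂ (S M)).toLinearMap ∘ₗ gen m

theorem YS_apply (M : ZhuModuleCat.{u, w} A) (a : V) (m : ℤ) (x : S M) :
    YS M a m x = gen m a • x := rfl

/-! ### The maps `S(f)` -/

section Maps

variable {M₁ M₂ : ZhuModuleCat.{u, w} A} (f : M₁ ⟶ M₂)

/-- The map `id ⊗ f`. -/
def mapTM : TM M₁ →ₗ[TAff V] TM M₂ :=
  LinearMap.baseChange (TAff V) (ZhuModuleCat.Hom.toLin f)

theorem mapTM_grTM {d : ℤ} {x : TM M₁} (hx : x ∈ grTM M₁ d) : mapTM f x ∈ grTM M₂ d := by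
  have key : ∀ {d : ℤ} {x : TM M₁}, IsMonomial M₁ d x → IsMonomial M₂ d (mapTM f x) := by
    intro d x h
    induction h with
    | of y => simpa [mapTM] using IsMonomial.of (M := M₂) (ZhuModuleCat.Hom.toLin f y)
    | act a ha m _ ih => rw [map_smul]; exact IsMonomial.act a ha m ih
  unfold grTM at hx ⊢
  induction hx using Submodule.span_induction with
  | mem x h => exact Submodule.subset_span (key h)
  | zero => rw [map_zero]; exact Submodule.zero_mem _
  | add x y _ _ hx hy => rw [map_add]; exact Submodule.add_mem _ hx hy
  | smul c x _ hx =>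
    rw [← algebraMap_smul (TAff V) c x, map_smul, algebraMap_smul]
    exact Submodule.smul_mem _ c hx

theorem subI_le_comap : subI M₁ ≤ (subI M₂).comap (mapTM f) := by
  refine Submodule.span_le.2 ?_
  intro x h
  refine Submodule.subset_span ?_
  change IGen M₂ (mapTM f x)
  cases (show IGen M₁ x from h) with
  | neg m a x ha hx h' => rw [map_smul]; exact IGen.neg m a _ ha (mapTM_grTM f hx) h'
  | zero a y =>
    have h := IGen.zero (M := M₂) a (ZhuModuleCat.Hom.toLin f y)
    rw [← ZhuModuleCat.Hom.isMap f] at h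
    simpa [mapTM] using h
  | prod p q a b x ha hb hx hq h' =>
    rw [map_sub, map_smul, map_smul, map_smul]
    exact IGen.prod p q a b _ ha hb (mapTM_grTM f hx) hq h'

/-- The map `S₁(M₁) → S₁(M₂)` induced by `id ⊗ f`. -/
def mapS₁ : S₁ M₁ →ₗ[TAff V] S₁ M₂ :=
  Submodule.mapQ _ _ (mapTM f) (subI_le_comap f)

theorem mapS₁_grS₁ {d : ℤ} {x : S₁ M₁} (hx : x ∈ grS₁ M₁ d) : mapS₁ f x ∈ grS₁ M₂ d := by
  obtain ⟨y, hy, rfl⟩ := hx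
  exact ⟨mapTM f y, mapTM_grTM f hy, rfl⟩

theorem subJ_le_comap : subJ M₁ ≤ (subJ M₂).comap (mapS₁ f) := by
  refine Submodule.span_le.2 ?_
  intro x h
  refine Submodule.subset_span ?_
  change JGen M₂ (mapS₁ f x)
  cases (show JGen M₁ x from h) with
  | mk K m a b x ha hb hx h' =>
    rw [map_smul]
    exact JGen.mk K m a b _ ha hb (mapS₁_grS₁ f hx) h'

/-- The map `S(f) : S(M₁) → S(M₂)` induced by `id ⊗ f`. -/
def mapS : S M₁ →ₗ[ℂ] S M₂ :=
  (Submodule.mapQ _ _ (mapS₁ f) (subJ_le_comap f)).restrictScalars ℂ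

end Maps

end ZhuFunctor

end

open ZhuFunctor

/-!
# The functor `M ↦ S(M)` from `A(V)`-modules to `ℕ`-gradable weak `V`-modules

The substance of the theorem is that `S(M)` is a weak module; functoriality is formal.

**Jacobi identity.** Fix homogeneous `a`, `b` in `V` and `x` in `S(M)`, put `N = wt a + deg x` and
`N' = wt b + deg x`, and fix `s`. The three families `a(s - q) b(q) x`, `b(s - p) a(p) x` and
`(a_n b)(s - n) x` are sequences indexed by `ℤ` that vanish for large indices. They define
functionals `G`, `G'`, `H` on `ℂ[z, z⁻¹, (z - 1)⁻¹]` through the expansions at `z = ∞`, `0`, `1`,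
and the Jacobi identity says that `H = G - G'` on every `z ^ m (z - 1) ^ n`. As functions of
`(m, n)`, all three satisfy the recursion `F (m + 1) n = F m n + F m (n + 1)`, since
`z = 1 + (z - 1)`.

The generators of `𝓘` express `a(p) b(q) x` through the values of `H` on `z ^ N ℂ[(z - 1)^±1]`, and
those of `𝓙` say that `H` vanishes on `z ^ N (z - 1) ^ n` for small `n`. Together they give `H = G`
on `z ^ N ℂ[(z - 1)^±1]`, where `G' = 0` for reasons of degree (`YS_assoc`). The same statement for
the pair `(b, a)`, rewritten by skew-symmetry in `V` (`skew_symmetry`, `YS_skew`), gives `H = -G'`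
on the span of the `z ^ (s - N' - n) (z - 1) ^ n`, where `G = 0`. The recursion spreads
`H = G - G'` from these two families to all `(m, n)` (`jacobi_of_assoc`).

**Vacuum.** No relation mentions the vacuum except through `ρ(𝟏 + O(V)) = 1`. Associativity for the
pair `(𝟏, b)` determines the sequence `𝟏(s - q) b(q) x`, which gives the vacuum property on all
vectors `b(q) x` (`vacuum_YS`); a vector of `M` is of this form with `b = 𝟏` and `q = -1`. With the
vacuum property, associativity for the pair `(a, 𝟏)` yields the translation property needed for
skew-symmetry (`YS_translation`).

**Grading.** Scaling by `2 ^ d` in degree `d` comes from an algebra endomorphism of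
`T(V[t, t⁻¹])`, hence descends to the quotient `S(M)` by homogeneous relations. The homogeneous
subspaces of `S(M)` lie in eigenspaces of the induced map for distinct eigenvalues, so their sum is
direct (`grS_isInternal`).
-/

namespace ZhuFunctor

/-! ### Sequences that vanish for large indices -/

section Sequences

variable {W : Type*} [AddCommGroup W]

/-- The sequence `n ↦ ∑ i, c i • f (n + i)`. For `c = Ring.choose m` it is the result of applying
`(1 + τ) ^ m` to `f`, where `τ` is the shift `(τ f) n = f (n + 1)`. -/
noncomputable def shiftSum (c : ℕ → ℤ) (f : ℤ → W) (n : ℤ) : W :=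
  ∑ᶠ i : ℕ, c i • f (n + i)

/-- The coefficients `(-1) ^ i (n choose i)` of `(1 - τ) ^ n`. -/
def altChoose (n : ℤ) (i : ℕ) : ℤ := (-1) ^ i * Ring.choose n i

theorem shiftSum_eq_sum {f : ℤ → W} {B : ℤ} (hf : ∀ n, B ≤ n → f n = 0) (c : ℕ → ℤ) {n : ℤ}
    {T : ℕ} (hT : B ≤ n + T) : shiftSum c f n = ∑ i ∈ Finset.range T, c i • f (n + i) := by
  refine finsum_eq_sum_of_support_subset _ fun i hi => ?_
  by_contra h
  simp only [Finset.coe_range, Set.mem_Iio, not_lt] at h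
  exact hi (by simp only [hf (n + i) (by omega), smul_zero])

theorem shiftSum_eq_zero {f : ℤ → W} {B : ℤ} (hf : ∀ n, B ≤ n → f n = 0) (c : ℕ → ℤ) {n : ℤ}
    (hn : B ≤ n) : shiftSum c f n = 0 := by
  rw [shiftSum_eq_sum hf c (T := 0) (by simpa using hn)]; simp

theorem shiftSum_eq_self {c : ℕ → ℤ} (h0 : c 0 = 1) (hs : ∀ i, c (i + 1) = 0) (f : ℤ → W)
    (n : ℤ) : shiftSum c f n = f n := by
  unfold shiftSum
  rw [finsum_eq_single _ 0]
  · simp [h0]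
  · intro i hi
    obtain ⟨i, rfl⟩ := Nat.exists_eq_succ_of_ne_zero hi
    rw [Nat.succ_eq_add_one, hs, zero_smul]

theorem binSum_zero (f : ℤ → W) (n : ℤ) : shiftSum (Ring.choose 0) f n = f n :=
  shiftSum_eq_self (by simp) (fun _ => by rw [Ring.choose_zero_succ]) f n

theorem altSum_zero (f : ℤ → W) (n : ℤ) : shiftSum (altChoose 0) f n = f n :=
  shiftSum_eq_self (by simp [altChoose]) (fun _ => by simp [altChoose, Ring.choose_zero_succ]) f n

theorem shiftSum_sub {f f' : ℤ → W} {B : ℤ} (hf : ∀ n, B ≤ n → f n = 0)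
    (hf' : ∀ n, B ≤ n → f' n = 0) (c : ℕ → ℤ) (n : ℤ) :
    shiftSum c (fun n => f n - f' n) n = shiftSum c f n - shiftSum c f' n := by
  obtain ⟨T, hT⟩ : ∃ T : ℕ, B ≤ n + T := ⟨(B - n).toNat, by omega⟩
  rw [shiftSum_eq_sum hf c hT, shiftSum_eq_sum hf' c hT,
    shiftSum_eq_sum (B := B) (fun n hn => by rw [hf n hn, hf' n hn, sub_zero]) c hT,
    ← Finset.sum_sub_distrib]
  exact Finset.sum_congr rfl fun i _ => smul_sub _ _ _

theorem binSum_natCast (N : ℕ) (f : ℤ → W) (n : ℤ) :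
    shiftSum (Ring.choose (N : ℤ)) f n =
      ∑ j ∈ Finset.range (N + 1), Ring.choose (N : ℤ) j • f (n + j) := by
  refine finsum_eq_sum_of_support_subset _ fun i hi => ?_
  by_contra h
  simp only [Finset.coe_range, Set.mem_Iio, not_lt] at h
  refine hi ?_
  dsimp only
  rw [Ring.choose_natCast, Nat.choose_eq_zero_of_lt (by omega), Nat.cast_zero, zero_smul]

theorem shiftSum_pascal {f : ℤ → W} {B : ℤ} (hf : ∀ n, B ≤ n → f n = 0) {c c' : ℕ → ℤ} (e : ℤ)
    (h0 : c' 0 = c 0) (hs : ∀ i, c' (i + 1) = c (i + 1) + e * c i) (n : ℤ) :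
    shiftSum c' f n = shiftSum c f n + e • shiftSum c f (n + 1) := by
  obtain ⟨T, hT⟩ : ∃ T : ℕ, B ≤ n + T := ⟨(B - n).toNat, by omega⟩
  rw [shiftSum_eq_sum hf c' (T := T + 1) (by push_cast; omega),
    shiftSum_eq_sum hf c (T := T + 1) (by push_cast; omega),
    shiftSum_eq_sum hf c (n := n + 1) (T := T) (by omega), Finset.sum_range_succ',
    Finset.sum_range_succ', h0, Finset.smul_sum, add_right_comm, ← Finset.sum_add_distrib]
  congr 1
  refine Finset.sum_congr rfl fun i _ => ?_
  rw [hs, add_smul, mul_smul]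
  congr 3
  push_cast
  ring_nf

theorem choose_pascal (m : ℤ) (i : ℕ) :
    Ring.choose (m + 1) (i + 1) = Ring.choose m (i + 1) + 1 * Ring.choose m i := by
  rw [Ring.choose_succ_succ]; ring

theorem binSum_pascal {f : ℤ → W} {B : ℤ} (hf : ∀ n, B ≤ n → f n = 0) (m n : ℤ) :
    shiftSum (Ring.choose (m + 1)) f n =
      shiftSum (Ring.choose m) f n + shiftSum (Ring.choose m) f (n + 1) := by
  rw [shiftSum_pascal hf 1 (by simp) (choose_pascal m), one_smul]

theorem altSum_pascal {f : ℤ → W} {B : ℤ} (hf : ∀ n, B ≤ n → f n = 0) (n k : ℤ) :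
    shiftSum (altChoose (n + 1)) f k =
      shiftSum (altChoose n) f k - shiftSum (altChoose n) f (k + 1) := by
  rw [shiftSum_pascal hf (-1) (by simp [altChoose]) (c := altChoose n), neg_one_smul,
    sub_eq_add_neg]
  intro i
  simp only [altChoose, choose_pascal]
  ring

theorem shiftSum_delta (c : ℕ → ℤ) (r : ℤ) (x : W) (n : ℤ) :
    shiftSum c (fun q => if q = r then x else 0) n =
      if n ≤ r then c (r - n).toNat • x else 0 := by
  unfold shiftSum
  split_ifs with h
  · rw [finsum_eq_single _ (r - n).toNat]
    · dsimp only
      rw [if_pos (by omega)]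
    · intro i hi
      dsimp only
      rw [if_neg (by omega), smul_zero]
  · exact finsum_eq_zero_of_forall_eq_zero fun i => by
      dsimp only
      rw [if_neg (by omega), smul_zero]

/-- A function on `ℤ × ℤ` with the recursion of Pascal's triangle vanishes if it vanishes on a row
`n = n₀` and, in each row, for all small `m`. -/
theorem pascal_eq_zero_of_row {e : ℤ → ℤ → W} (he : ∀ m n, e (m + 1) n = e m n + e m (n + 1))
    (n₀ : ℤ) (h₀ : ∀ m, e m n₀ = 0) (hs : ∀ n, ∃ B, ∀ m ≤ B, e m n = 0) (m n : ℤ) : e m n = 0 := by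
  induction n using Int.inductionOn' (b := n₀) generalizing m with
  | zero => exact h₀ m
  | succ n _ ih =>
    have := he m n
    rw [ih, ih, zero_add] at this
    exact this.symm
  | pred n _ ih =>
    have hc : ∀ m, e (m + 1) (n - 1) = e m (n - 1) := fun m => by
      rw [he, sub_add_cancel, ih, add_zero]
    obtain ⟨B, hB⟩ := hs (n - 1)
    induction m using Int.inductionOn' (b := B) with
    | zero => exact hB B le_rfl
    | succ m _ ihm => rw [hc, ihm]
    | pred m hm _ => exact hB _ (by omega)

/-- A function on `ℤ × ℤ` with the recursion of Pascal's triangle vanishes if it vanishes on a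
column `m = m₀` and, in each column, for all small `n`. -/
theorem pascal_eq_zero_of_column {e : ℤ → ℤ → W} (he : ∀ m n, e (m + 1) n = e m n + e m (n + 1))
    (m₀ : ℤ) (h₀ : ∀ n, e m₀ n = 0) (hs : ∀ m, ∃ B, ∀ n ≤ B, e m n = 0) (m n : ℤ) : e m n = 0 := by
  induction m using Int.inductionOn' (b := m₀) generalizing n with
  | zero => exact h₀ n
  | succ m _ ih => rw [he, ih, ih, add_zero]
  | pred m _ ih =>
    have hc : ∀ n, e (m - 1) (n + 1) = - e (m - 1) n := fun n => by
      have := he (m - 1) n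
      rw [sub_add_cancel, ih] at this
      exact eq_neg_of_add_eq_zero_right this.symm
    obtain ⟨B, hB⟩ := hs (m - 1)
    induction n using Int.inductionOn' (b := B) with
    | zero => exact hB B le_rfl
    | succ n _ ihn => rw [hc, ihn, neg_zero]
    | pred n hn _ => exact hB _ (by omega)

/-- The system `∑ i, c n i • f (n + i) = 0` is triangular, so it has no nonzero solution that
vanishes for large indices. -/
theorem eq_zero_of_shiftSum_eq_zero {f : ℤ → W} {B : ℤ} (hf : ∀ n, B ≤ n → f n = 0)
    (c : ℤ → ℕ → ℤ) (hc : ∀ n, c n 0 = 1) (h : ∀ n, shiftSum (c n) f n = 0) (n : ℤ) : f n = 0 := by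
  suffices H : ∀ t : ℕ, ∀ n, B - t ≤ n → f n = 0 from H (B - n).toNat n (by omega)
  intro t
  induction t with
  | zero => simpa using hf
  | succ t ih =>
    intro n hn
    have h1 := h n
    rw [shiftSum_eq_sum ih (c n) (T := 1) (by push_cast at *; omega)] at h1
    simpa [hc] using h1

/-- Upper negation: the coefficient of `z⁻¹` in the expansion of `z ^ M (z - 1) ^ (-1 - j)` at
`z = ∞` is the coefficient of `(z - 1) ^ j` in `z ^ M`. -/
theorem altChoose_neg (M j : ℕ) :
    (if j ≤ M then altChoose (-1 - j) (M - j) else 0) = Ring.choose (M : ℤ) j := by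
  rw [Ring.choose_natCast]
  split_ifs with h
  · rw [altChoose, show (-1 - j : ℤ) = -(1 + j) by ring, Ring.choose_neg]
    rw [show (1 + j + (M - j : ℕ) - 1 : ℤ) = (M : ℕ) by push_cast [h]; ring, Ring.choose_natCast,
      Units.smul_def, Int.negOnePow_def]
    rw [Nat.choose_symm h]
    simp [← mul_assoc, ← mul_pow]
  · rw [Nat.choose_eq_zero_of_lt (by omega)]; rfl

/-- The expansions of `z ^ M (z - 1) ^ n` in powers of `z - 1` and of `z⁻¹` have the same
residue. -/
theorem binSum_delta_eq_altSum_delta (M : ℕ) (x : W) (s n : ℤ) :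
    shiftSum (Ring.choose (M : ℤ)) (fun q => if q = -1 then x else 0) n =
      shiftSum (altChoose n) (fun q => if q = s + 1 then x else 0) (s - M - n) := by
  rw [shiftSum_delta, shiftSum_delta, show s + 1 - (s - M - n) = M + n + 1 by ring]
  rcases lt_or_ge n 0 with hn | hn
  · obtain ⟨j, rfl⟩ : ∃ j : ℕ, n = -1 - j := ⟨(-1 - n).toNat, by omega⟩
    rw [if_pos (by omega), show (-1 - (-1 - (j : ℤ))).toNat = j by omega, ← altChoose_neg]
    split_ifs with h1 h2 h2
    · rw [show ((M : ℤ) + (-1 - j) + 1).toNat = M - j by omega]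
    · omega
    · omega
    · rw [zero_smul]
  · obtain ⟨n, rfl⟩ := Int.eq_ofNat_of_zero_le hn
    rw [if_neg (by omega), if_pos (by omega), altChoose, Ring.choose_natCast,
      Nat.choose_eq_zero_of_lt (by omega), Nat.cast_zero, mul_zero, zero_smul]

theorem binSum_binSum {f : ℤ → W} {B : ℤ} (hf : ∀ n, B ≤ n → f n = 0) (M : ℕ) (c n : ℤ) :
    shiftSum (Ring.choose (M : ℤ)) (shiftSum (Ring.choose c) f) n =
      shiftSum (Ring.choose (M + c)) f n := by
  have hf' : ∀ n, B ≤ n → shiftSum (Ring.choose c) f n = 0 := fun n => shiftSum_eq_zero hf _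
  induction M generalizing n with
  | zero => rw [Nat.cast_zero, binSum_zero, zero_add]
  | succ M ih =>
    rw [Nat.cast_add, Nat.cast_one, binSum_pascal hf', ih, ih, add_right_comm, binSum_pascal hf]

/-- The residue form of associativity, with a bound on the poles
of the iterate, gives associativity: the functionals defined by `h` and `g` agree on
all `z ^ N (z - 1) ^ n`. -/
theorem binSum_eq_altSum {g h : ℤ → W} {s N N' : ℤ} (hg : ∀ q, N' ≤ q → g q = 0)
    (hpole : ∀ n, n ≤ s - N - N' → shiftSum (Ring.choose N) h n = 0)
    (hassoc : ∀ p, g (s - p) =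
      ∑ i ∈ Finset.range (N' - (s - p)).toNat,
        Ring.choose (p - N) i • shiftSum (Ring.choose N) h (p - N - i)) (n : ℤ) :
    shiftSum (Ring.choose N) h n = shiftSum (altChoose n) g (s - N - n) := by
  -- By `hpole`, `h` can be paired with expansions in powers of `(z - 1)⁻¹` on `z ^ N` times
  -- anything. The first term of `e m n` is its value on `z ^ N` times that expansion of
  -- `z ^ (m - N) (z - 1) ^ n`.
  set r : ℤ → W := fun t => shiftSum (Ring.choose N) h (-t) with hr
  have hr0 : ∀ t, N' + N - s ≤ t → r t = 0 := fun t ht => hpole _ (by omega)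
  let e : ℤ → ℤ → W := fun m n =>
    shiftSum (Ring.choose (m - N)) r (N - m - n) - shiftSum (altChoose n) g (s - m - n)
  have he : ∀ m n, e (m + 1) n = e m n + e m (n + 1) := by
    intro m n
    simp only [e]
    have h1 := binSum_pascal hr0 (m - N) (N - m - n - 1)
    have h2 := altSum_pascal hg n (s - m - n - 1)
    rw [show m + 1 - N = m - N + 1 by ring, show N - (m + 1) - n = N - m - n - 1 by ring, h1,
      show N - m - (n + 1) = N - m - n - 1 by ring, show s - m - (n + 1) = s - m - n - 1 by ring,
      h2, show s - (m + 1) - n = s - m - n - 1 by ring, sub_add_cancel, sub_add_cancel]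
    abel
  have key := pascal_eq_zero_of_row he 0 (fun m => ?_) (fun n => ⟨s - N' - n, fun m hm => ?_⟩) N n
  · simp only [e] at key
    rw [sub_self, binSum_zero] at key
    simpa [hr, sub_eq_zero] using key
  · simp only [e]
    rw [altSum_zero, sub_zero, sub_zero, hassoc, sub_eq_zero,
      shiftSum_eq_sum (B := N' + N - s) hr0 _ (T := (N' - (s - m)).toNat) (by omega)]
    refine Finset.sum_congr rfl fun i _ => ?_
    simp only [hr]
    congr 2
    ring
  · simp only [e]
    rw [shiftSum_eq_zero hr0 _ (by omega), shiftSum_eq_zero hg _ (by omega), sub_zero]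

/-- Associativity for both orders of the factors, with `g`, `g'`, `h` the sequences of the two
products and of the iterate, gives the Jacobi identity. -/
theorem jacobi_of_assoc {W : Type*} [AddCommGroup W] [Module ℂ W] {g g' h : ℤ → W}
    {s N N' Bh : ℤ} (hg : ∀ q, N' ≤ q → g q = 0)
    (hg' : ∀ p, N ≤ p → g' p = 0) (hh : ∀ n, Bh ≤ n → h n = 0)
    (h₁ : ∀ n, shiftSum (Ring.choose N) h n = shiftSum (altChoose n) g (s - N - n))
    (h₂ : ∀ n, shiftSum (Ring.choose (s - N' - n)) h n =
      -((-1 : ℂ) ^ n • shiftSum (altChoose n) g' (s - N' - n))) (m n : ℤ) :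
    shiftSum (Ring.choose m) h n = shiftSum (altChoose n) g (s - m - n) -
      (-1 : ℂ) ^ n • shiftSum (altChoose n) g' m := by
  let e : ℤ → ℤ → W := fun m n => shiftSum (Ring.choose m) h n -
    shiftSum (altChoose n) g (s - m - n) + (-1 : ℂ) ^ n • shiftSum (altChoose n) g' m
  have he : ∀ m n, e (m + 1) n = e m n + e m (n + 1) := by
    intro m n
    simp only [e]
    have h2 := altSum_pascal hg n (s - m - n - 1)
    rw [binSum_pascal hh, altSum_pascal hg', show s - (m + 1) - n = s - m - n - 1 by ring,
      show s - m - (n + 1) = s - m - n - 1 by ring, h2, sub_add_cancel,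
      zpow_add_one₀ (by norm_num), mul_neg_one, neg_smul, smul_sub]
    abel
  -- `h₂` is the case `t = 0`; the recursion gives the smaller values of `m + n`.
  have hdiag : ∀ t : ℕ, ∀ m n, m + n = s - N' - t → e m n = 0 := by
    intro t
    induction t with
    | zero =>
      intro m n hmn
      obtain rfl : m = s - N' - n := by push_cast at hmn; omega
      simp only [e]
      rw [h₂, shiftSum_eq_zero hg _ (by omega)]
      abel
    | succ t ih =>
      intro m n hmn
      have := he m n
      push_cast at hmn
      rw [ih (m + 1) n (by omega), ih m (n + 1) (by omega), add_zero] at this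
      exact this.symm
  have key := pascal_eq_zero_of_column he N (fun n => ?_) (fun m => ⟨s - N' - m, fun n hn =>
    hdiag (s - N' - m - n).toNat _ _ (by omega)⟩) m n
  · rw [← sub_eq_zero, ← key]
    simp only [e]
    abel
  · simp only [e]
    rw [h₁, shiftSum_eq_zero hg' _ le_rfl, smul_zero, sub_self, add_zero]

/-- If `h'` is obtained from `h` by exchanging the two factors, that is, by the substitution of
`z ^ s f(1 / z)` for `f(z)`, then `z ^ m (z - 1) ^ n` is replaced by
`(-1) ^ n z ^ (s - m - n) (z - 1) ^ n`. -/
theorem binSum_swap {W : Type*} [AddCommGroup W] [Module ℂ W] {h h' : ℤ → W} {s B : ℤ}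
    (hh : ∀ n, B ≤ n → h n = 0) (hh' : ∀ n, B ≤ n → h' n = 0)
    (hs : ∀ n, h' n = -((-1 : ℂ) ^ n • shiftSum (Ring.choose (s - n)) h n)) (m : ℕ) (n : ℤ) :
    shiftSum (Ring.choose (m : ℤ)) h' n =
      -((-1 : ℂ) ^ n • shiftSum (Ring.choose (s - m - n)) h n) := by
  induction m generalizing n with
  | zero =>
    rw [Nat.cast_zero, binSum_zero, hs, sub_zero]
  | succ m ih =>
    rw [Nat.cast_add, Nat.cast_one, binSum_pascal hh', ih, ih]
    have := binSum_pascal hh (s - (m + 1) - n) n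
    rw [show s - (m + 1 : ℤ) - n + 1 = s - m - n by ring] at this
    rw [this, show s - m - (n + 1) = s - (m + 1) - n by ring, zpow_add_one₀ (by norm_num),
      mul_neg_one, neg_smul, smul_add]
    abel

end Sequences

/-! ### The vertex algebra `V` -/

section Vertex

variable {V : Type u} [AddCommGroup V] [Module ℂ V] (A : NGradedVertexAlgebra V)

theorem homogeneous_induction {W : Type*} [AddCommGroup W] [Module ℂ W] {gr : ℤ → Submodule ℂ W}
    (h : iSup gr = ⊤) {P : W → Prop} (hom : ∀ k, ∀ a ∈ gr k, P a)
    (add : ∀ a b, P a → P b → P (a + b)) (a : W) : P a :=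
  Submodule.iSup_induction gr (motive := P) (h ▸ Submodule.mem_top) hom
    (hom 0 0 (Submodule.zero_mem _)) add

variable {A} in
theorem eq_zero_or_weight_nonneg {k : ℤ} {a : V} (ha : a ∈ A.gr k) : a = 0 ∨ 0 ≤ k := by
  rcases lt_or_ge k 0 with h | h
  · rw [A.gr_neg k h] at ha
    exact Or.inl ha
  · exact Or.inr h

theorem decompose_symm_lof (k : ℤ) (a : A.gr k) :
    (decompose A).symm (DirectSum.lof ℂ ℤ (fun k => A.gr k) k a) = a :=
  DirectSum.coeLinearMap_lof ..

theorem decompose_of_mem {k : ℤ} {a : V} (ha : a ∈ A.gr k) :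
    decompose A a = DirectSum.lof ℂ ℤ (fun k => A.gr k) k ⟨a, ha⟩ := by
  rw [← LinearEquiv.eq_symm_apply, decompose_symm_lof]

/-- The projection of `V` to its homogeneous component of weight `j`. -/
noncomputable def weightProj (j : ℤ) : V →ₗ[ℂ] V :=
  (A.gr j).subtype ∘ₗ DirectSum.component ℂ ℤ (fun k => A.gr k) j ∘ₗ (decompose A).toLinearMap

theorem weightProj_of_mem {k : ℤ} {a : V} (ha : a ∈ A.gr k) (j : ℤ) :
    weightProj A j a = if j = k then a else 0 := by
  simp only [weightProj, LinearMap.comp_apply, LinearEquiv.coe_coe, decompose_of_mem A ha]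
  split_ifs with h
  · subst h
    rw [DirectSum.component.lof_self]
    rfl
  · rw [DirectSum.component.of, dif_neg (Ne.symm h), map_zero]

/-- The components of `𝟏` of nonzero weight act as zero under `Y(-)_{-1}`, as `𝟏_{-1}` preserves
weights. -/
theorem vac_mem : A.vac ∈ A.gr 0 := by
  have hV := A.internal.submodule_iSup_eq_top
  have key : ∀ j, j ≠ 0 → weightProj A j A.vac = 0 := by
    intro j hj
    have h1 : ∀ b : V, A.Y (weightProj A j A.vac) (-1) b = 0 := by
      intro b
      induction b using homogeneous_induction hV with
      | hom l b hb =>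
        have h2 : ∀ a : V, weightProj A (l + j) (A.Y a (-1) b) = A.Y (weightProj A j a) (-1) b := by
          intro a
          induction a using homogeneous_induction hV with
          | hom k a ha =>
            rw [weightProj_of_mem A ha, weightProj_of_mem A (A.homogeneous k l (-1) a b ha hb)]
            by_cases h : j = k
            · rw [if_pos h, if_pos (by omega)]
            · rw [if_neg h, if_neg (by omega)]; simp
          | add a a' h h' => simp [h, h']
        rw [← h2, A.vacuum, if_pos rfl, weightProj_of_mem A hb, if_neg (by omega)]
      | add b b' h h' => rw [map_add, h, h', add_zero]
    simpa [A.creation] using h1 A.vac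
  have h0 : decompose A A.vac = DirectSum.lof ℂ ℤ (fun k => A.gr k) 0 (decompose A A.vac 0) := by
    refine DFinsupp.ext fun j => ?_
    by_cases hj : j = 0
    · subst hj
      exact (DirectSum.of_eq_same (β := fun k => A.gr k) 0 _).symm
    · have h1 : decompose A A.vac j = 0 := Subtype.ext (key j hj)
      rw [h1]
      exact (DirectSum.of_eq_of_ne (β := fun k => A.gr k) 0 j _ hj).symm
  rw [← (decompose A).symm_apply_apply A.vac, h0, decompose_symm_lof]
  exact Subtype.property _

/-- Skew-symmetry of the vertex operator map of `V`, with `(c_{-1-i}) 𝟏` for `D ^ i c / i!`. -/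
theorem skew_symmetry (a b : V) (n : ℤ) : A.Y b n a =
    -((-1 : ℂ) ^ n • ∑ᶠ i : ℕ, Ring.choose (-1 : ℤ) i • A.Y (A.Y a (n + i) b) (-1 - i) A.vac) := by
  -- For these exponents the first product vanishes and the second has the single
  -- term `b_n a_{-1} 𝟏`.
  have h := A.jacobi a b A.vac (-1) n 0
  rw [finsum_eq_zero_of_forall_eq_zero (f := fun i : ℕ => ((-1 : ℤ) ^ i * Ring.choose n i) •
      A.Y a (-1 + n - i) (A.Y b (0 + i) A.vac))
      (fun i => by rw [A.creation_nonneg _ _ (by omega), map_zero, smul_zero]), zero_sub,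
    finsum_eq_single (fun i : ℕ => ((-1 : ℤ) ^ i * Ring.choose n i) •
      A.Y b (n + 0 - i) (A.Y a (-1 + i) A.vac)) 0
      (fun i hi => by rw [A.creation_nonneg _ _ (by omega), map_zero, smul_zero])] at h
  simp only [add_zero, Nat.cast_zero, sub_zero, pow_zero, Ring.choose_zero_right, one_mul, one_smul,
    A.creation] at h
  rw [h, smul_neg, neg_neg, smul_smul, ← mul_zpow]
  simp

end Vertex

/-! ### Associativity, vacuum and Jacobi identity on `S(M)` -/

section Module

variable {V : Type u} [AddCommGroup V] [Module ℂ V] {A : NGradedVertexAlgebra V}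
  {M : ZhuModuleCat.{u, w} A}

theorem gen_smul_mem_grTM {k d : ℤ} {a : V} (ha : a ∈ A.gr k) (m : ℤ) {x : TM M}
    (hx : x ∈ grTM M d) : gen m a • x ∈ grTM M (k - m - 1 + d) := by
  unfold grTM at hx ⊢
  induction hx using Submodule.span_induction with
  | mem x h => exact Submodule.subset_span (IsMonomial.act a ha m h)
  | zero => rw [smul_zero]; exact Submodule.zero_mem _
  | add x y _ _ hx hy => rw [smul_add]; exact Submodule.add_mem _ hx hy
  | smul c x _ hx => rw [smul_comm]; exact Submodule.smul_mem _ c hx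

theorem mem_subI_of_neg {d : ℤ} (hd : d < 0) {x : TM M} (hx : x ∈ grTM M d) : x ∈ subI M := by
  unfold grTM at hx
  induction hx using Submodule.span_induction with
  | mem x h =>
    cases (show IsMonomial M d x from h) with
    | of => omega
    | act a ha m hx =>
      exact Submodule.subset_span (IGen.neg m a _ ha (Submodule.subset_span hx) hd)
  | zero => exact Submodule.zero_mem _
  | add x y _ _ hx hy => exact Submodule.add_mem _ hx hy
  | smul c x _ hx => exact Submodule.smul_of_tower_mem _ c hx

/-- The quotient map `T(V[t, t⁻¹]) ⊗ M → S(M)`. -/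
noncomputable def toS (M : ZhuModuleCat.{u, w} A) : TM M →ₗ[TAff V] S M :=
  (subJ M).mkQ ∘ₗ (subI M).mkQ

theorem toS_surjective : Function.Surjective (toS M) :=
  (Submodule.mkQ_surjective _).comp (Submodule.mkQ_surjective _)

theorem toS_eq_zero {x : TM M} (hx : x ∈ subI M) : toS M x = 0 := by
  simp only [toS, LinearMap.comp_apply, (Submodule.Quotient.mk_eq_zero _).2 hx,
    Submodule.mkQ_apply, Submodule.Quotient.mk_zero]

theorem mem_grS_iff {d : ℤ} {x : S M} : x ∈ grS M d ↔ ∃ y ∈ grTM M d, toS M y = x := by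
  constructor
  · rintro ⟨_, ⟨y, hy, rfl⟩, rfl⟩
    exact ⟨y, hy, rfl⟩
  · rintro ⟨y, hy, rfl⟩
    exact ⟨_, ⟨y, hy, rfl⟩, rfl⟩

theorem grS_eq_map (d : ℤ) : grS M d = (grTM M d).map ((toS M).restrictScalars ℂ) :=
  Submodule.ext fun _ => mem_grS_iff

theorem YS_toS (a : V) (m : ℤ) (x : TM M) : YS M a m (toS M x) = toS M (gen m a • x) := by
  rw [YS_apply, map_smul]

theorem YS_mem_grS {k d : ℤ} {a : V} (ha : a ∈ A.gr k) (m : ℤ) {x : S M} (hx : x ∈ grS M d) :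
    YS M a m x ∈ grS M (k - m - 1 + d) := by
  obtain ⟨y, hy, rfl⟩ := mem_grS_iff.1 hx
  rw [YS_toS]
  exact mem_grS_iff.2 ⟨_, gen_smul_mem_grTM ha m hy, rfl⟩

theorem grS_neg {d : ℤ} (hd : d < 0) : grS M d = ⊥ := by
  rw [eq_bot_iff]
  intro x hx
  obtain ⟨y, hy, rfl⟩ := mem_grS_iff.1 hx
  exact toS_eq_zero (mem_subI_of_neg hd hy)

theorem eq_zero_or_degree_nonneg {d : ℤ} {x : S M} (hx : x ∈ grS M d) : x = 0 ∨ 0 ≤ d := by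
  rcases lt_or_ge d 0 with h | h
  · rw [grS_neg h] at hx
    exact Or.inl hx
  · exact Or.inr h

theorem YS_eq_zero {k d m : ℤ} {a : V} {x : S M} (ha : a ∈ A.gr k) (hx : x ∈ grS M d)
    (h : k + d ≤ m) : YS M a m x = 0 := by
  have := YS_mem_grS ha m hx
  rw [grS_neg (by omega)] at this
  exact this

theorem truncSum_smul {k l d K m : ℤ} {a b : V} {x : S M} (ha : a ∈ A.gr k) (hb : b ∈ A.gr l)
    (hx : x ∈ grS M d) (h : m ≤ K - 2 * d - 2) : truncSum A k l d K m a b • x = 0 := by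
  obtain ⟨y, hy, rfl⟩ := hx
  have h1 : truncSum A k l d K m a b • y ∈ subJ M :=
    Submodule.subset_span (JGen.mk K m a b y ha hb hy h)
  exact (Submodule.Quotient.mk_eq_zero _).2 h1

/-- The formula defining the products in `S₁(M)` holds in `S(M)` without the bounds on `p` and `q`,
beyond which both of its sides vanish. -/
theorem YS_YS_eq_iterateSum {k l d : ℤ} {a b : V} {x : S M} (ha : a ∈ A.gr k) (hb : b ∈ A.gr l)
    (hx : x ∈ grS M d) (p q : ℤ) :
    YS M a p (YS M b q x) = iterateSum A k l d p q a b • x := by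
  rcases le_or_gt (l + d) q with hq | hq
  · rw [YS_eq_zero hb hx hq, map_zero, iterateSum, show (l + d - q).toNat = 0 by omega]
    simp
  rcases lt_or_ge ((k - p - 1) + (l - q - 1) + d) 0 with h | h
  · rw [YS_eq_zero ha (YS_mem_grS hb q hx) (by omega), iterateSum, Finset.sum_smul]
    refine (Finset.sum_eq_zero fun i _ => ?_).symm
    rw [Finset.sum_smul]
    refine Finset.sum_eq_zero fun j _ => ?_
    rw [smul_assoc, ← YS_apply, YS_eq_zero (A.homogeneous k l _ a b ha hb) hx (by omega), smul_zero]
  · obtain ⟨y, hy, rfl⟩ := mem_grS_iff.1 hx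
    rw [YS_toS, YS_toS, ← map_smul, ← sub_eq_zero, ← map_sub]
    exact toS_eq_zero (Submodule.subset_span (IGen.prod p q a b y ha hb hy hq h))

theorem exists_bound (a b : V) (s : ℤ) (x : S M) :
    ∃ B : ℤ, ∀ n, B ≤ n → YS M (A.Y a n b) (s - n) x = 0 := by
  obtain ⟨B, hB⟩ := A.truncated a b
  exact ⟨B, fun n hn => by rw [hB n hn, map_zero]; rfl⟩

/-- Weak associativity in `S(M)`, in components:
`(x₀ + x₂) ^ N Y(a, x₀ + x₂) Y(b, x₂) x = (x₀ + x₂) ^ N Y(Y(a, x₀) b, x₂) x` for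
`N = wt a + deg x`. -/
theorem YS_assoc {k l d : ℤ} {a b : V} {x : S M} (ha : a ∈ A.gr k) (hb : b ∈ A.gr l)
    (hx : x ∈ grS M d) (s n : ℤ) :
    shiftSum (Ring.choose (k + d)) (fun n => YS M (A.Y a n b) (s - n) x) n =
      shiftSum (altChoose n) (fun q => YS M a (s - q) (YS M b q x)) (s - (k + d) - n) := by
  rcases eq_zero_or_weight_nonneg ha with rfl | hk
  · simp [shiftSum]
  rcases eq_zero_or_degree_nonneg hx with rfl | hd
  · simp [shiftSum]
  obtain ⟨N, hN⟩ : ∃ N : ℕ, k + d = N := ⟨(k + d).toNat, by omega⟩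
  have hbin : ∀ n, shiftSum (Ring.choose (k + d)) (fun n => YS M (A.Y a n b) (s - n) x) n =
      ∑ j ∈ Finset.range (k + d + 1).toNat,
        Ring.choose (k + d) j • YS M (A.Y a (n + j) b) (s - (n + j)) x := fun n => by
    rw [hN, binSum_natCast, show (N + 1 : ℤ).toNat = N + 1 by omega]
  refine binSum_eq_altSum (N' := l + d) (fun q hq => ?_) (fun n hn => ?_) (fun p => ?_) n
  · rw [YS_eq_zero hb hx hq, map_zero]
  · rw [hbin, ← truncSum_smul (K := s + 2 - k - l) (m := n) ha hb hx (by omega), truncSum,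
      Finset.sum_smul]
    refine Finset.sum_congr rfl fun j _ => ?_
    rw [smul_assoc, ← YS_apply, add_comm (j : ℤ) n,
      show s + 2 - k - l + k + l - j - n - 2 = s - (n + j) by ring]
  · rw [YS_YS_eq_iterateSum ha hb hx, iterateSum, Finset.sum_smul, sub_sub_cancel]
    refine Finset.sum_congr rfl fun i _ => ?_
    rw [hbin, Finset.sum_smul, Finset.smul_sum]
    refine Finset.sum_congr rfl fun j _ => ?_
    rw [smul_assoc, mul_smul, ← YS_apply, show p - k - d - i + j = p - (k + d) - i + j by ring,
      show s - p + k + d + i - j = s - (p - (k + d) - i + j) by ring, sub_sub p k d]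

/-- The vacuum property on vectors `b(q) x`: associativity for the pair `(𝟏, b)` determines the
sequence `q ↦ 𝟏(s - q) b(q) x`, and the sequence supported at `q = s + 1` satisfies it too. -/
theorem vacuum_YS {l d : ℤ} {b : V} {x : S M} (hb : b ∈ A.gr l) (hx : x ∈ grS M d) (p q : ℤ) :
    YS M A.vac p (YS M b q x) = if p = -1 then YS M b q x else 0 := by
  rcases eq_zero_or_degree_nonneg hx with rfl | hd
  · simp
  obtain ⟨N, rfl⟩ : ∃ N : ℕ, d = N := ⟨d.toNat, by omega⟩
  obtain ⟨s, hs⟩ : ∃ s, s = p + q := ⟨_, rfl⟩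
  obtain ⟨B, hB1, hB2⟩ : ∃ B : ℤ, l + N ≤ B ∧ s + 2 ≤ B := ⟨_, le_max_left _ _, le_max_right _ _⟩
  have hf1 : ∀ q, B ≤ q → YS M A.vac (s - q) (YS M b q x) = 0 := fun q hq => by
    rw [YS_eq_zero hb hx (by omega), map_zero]
  have hf2 : ∀ q, B ≤ q → (if q = s + 1 then YS M b (s + 1) x else 0) = 0 := fun q hq =>
    if_neg (by omega)
  have key := eq_zero_of_shiftSum_eq_zero (B := B)
    (f := fun q => YS M A.vac (s - q) (YS M b q x) - if q = s + 1 then YS M b (s + 1) x else 0)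
    (fun q hq => by rw [hf1 q hq, hf2 q hq, sub_zero]) (fun n => altChoose (s - N - n))
    (fun n => by simp [altChoose]) (fun n => ?_) q
  · rw [show s - q = p by omega, sub_eq_zero] at key
    rw [key]
    by_cases h : p = -1
    · rw [if_pos h, if_pos (by omega), show s + 1 = q by omega]
    · rw [if_neg h, if_neg (by omega)]
  · have h1 := YS_assoc (vac_mem A) hb hx s (s - N - n)
    rw [zero_add, sub_sub_cancel] at h1
    have h2 := binSum_delta_eq_altSum_delta N (YS M b (s + 1) x) s (s - N - n)
    rw [sub_sub_cancel] at h2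
    rw [shiftSum_sub hf1 hf2, ← h1, ← h2, sub_eq_zero]
    congr 1
    funext n
    rw [A.vacuum]
    split_ifs with h
    · rw [h, sub_neg_eq_add]
    · rw [map_zero]; rfl

theorem YS_vac_of_monomial {d : ℤ} {x : TM M} (hx : IsMonomial M d x) (p : ℤ) :
    YS M A.vac p (toS M x) = if p = -1 then toS M x else 0 := by
  cases hx with
  | of y =>
    have hy : YS M A.vac (-1) (toS M (1 ⊗ₜ y)) = toS M (1 ⊗ₜ y) := by
      have h1 : oT A A.vac = gen (-1) A.vac := by
        simp [oT, decompose_of_mem A (vac_mem A)]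
      have h2 : toS M (oT A A.vac • (1 ⊗ₜ y) - 1 ⊗ₜ M.ρ (toZhu A A.vac) y) = 0 :=
        toS_eq_zero (Submodule.subset_span (IGen.zero A.vac y))
      rw [map_sub, sub_eq_zero, h1, M.ρ_one, ← YS_toS] at h2
      exact h2
    have h := vacuum_YS (vac_mem A)
      (mem_grS_iff.2 ⟨_, Submodule.subset_span (IsMonomial.of y), rfl⟩)
      p (-1) (x := toS M (1 ⊗ₜ y))
    rwa [hy] at h
  | act a ha m hx =>
    rw [← YS_toS]
    exact vacuum_YS ha (mem_grS_iff.2 ⟨_, Submodule.subset_span hx, rfl⟩) p m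

theorem YS_vac_of_mem {d : ℤ} {x : S M} (hx : x ∈ grS M d) (p : ℤ) :
    YS M A.vac p x = if p = -1 then x else 0 := by
  obtain ⟨y, hy, rfl⟩ := mem_grS_iff.1 hx
  unfold grTM at hy
  have hL : ∀ x : S M, (if p = -1 then x else 0) = (if p = -1 then LinearMap.id else 0 :
      S M →ₗ[ℂ] S M) x := fun x => by split_ifs <;> rfl
  induction hy using Submodule.span_induction with
  | mem y h => exact YS_vac_of_monomial h p
  | zero => simp
  | add y z hy hz h h' =>
    rw [map_add, map_add, h (mem_grS_iff.2 ⟨y, hy, rfl⟩), h' (mem_grS_iff.2 ⟨z, hz, rfl⟩), hL, hL,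
      hL, map_add]
  | smul c y hy h =>
    rw [LinearMap.map_smul_of_tower, map_smul, h (mem_grS_iff.2 ⟨y, hy, rfl⟩), hL, hL, map_smul]

/-- `Y(D ^ i a / i!, x) = (1 / i!) (d / dx) ^ i Y(a, x)` in components, with `a_{-1-i} 𝟏` for
`D ^ i a / i!`. -/
theorem YS_translation {k d : ℤ} {a : V} {x : S M} (ha : a ∈ A.gr k) (hx : x ∈ grS M d) (i : ℕ)
    (r : ℤ) : YS M (A.Y a (-1 - i) A.vac) r x = altChoose r i • YS M a (r - i) x := by
  rcases eq_zero_or_weight_nonneg ha with rfl | hk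
  · simp
  rcases eq_zero_or_degree_nonneg hx with rfl | hd
  · simp
  obtain ⟨N, hN⟩ : ∃ N : ℕ, k + d = N := ⟨(k + d).toNat, by omega⟩
  obtain ⟨s, hs⟩ : ∃ s : ℤ, s = r - 1 - i := ⟨_, rfl⟩
  set y := YS M a (s + 1) x with hy
  let δ : ℤ → S M := fun q => if q = -1 then y else 0
  have hδ : ∀ n : ℤ, 0 ≤ n → δ n = 0 := fun n hn => if_neg (by omega)
  have h1 : ∀ n : ℤ, 0 ≤ n → YS M (A.Y a n A.vac) (s - n) x = 0 := fun n hn => by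
    rw [A.creation_nonneg a n hn, map_zero]; rfl
  have h2 : ∀ n : ℤ, 0 ≤ n → shiftSum (Ring.choose (-s - 2)) δ n = 0 := fun n hn =>
    shiftSum_eq_zero hδ _ hn
  have key := eq_zero_of_shiftSum_eq_zero (B := 0)
    (f := fun n => YS M (A.Y a n A.vac) (s - n) x - shiftSum (Ring.choose (-s - 2)) δ n)
    (fun n hn => by rw [h1 n hn, h2 n hn, sub_zero]) (fun n => Ring.choose (N : ℤ))
    (fun n => by simp) (fun n => ?_) (-1 - i)
  · rw [sub_eq_zero, shiftSum_delta, if_pos (by omega), show s - (-1 - (i : ℤ)) = r by omega,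
      show (-1 - (-1 - (i : ℤ))).toNat = i by omega, hy, show s + 1 = r - i by omega,
      show -s - 2 = -(r + 1 - i) by omega, Ring.choose_neg,
      show r + 1 - i + i - 1 = r by ring] at key
    rw [key, altChoose, Units.smul_def, Int.negOnePow_def]
    simp
  · have h3 := YS_assoc ha (vac_mem A) hx s n
    have h4 : (fun q => YS M a (s - q) (YS M A.vac q x)) = δ := by
      funext q
      rw [YS_vac_of_mem hx]
      simp only [δ]
      split_ifs with h
      · rw [h, hy, sub_neg_eq_add]
      · rw [map_zero]
    rw [h4, hN] at h3
    rw [shiftSum_sub h1 h2, h3, binSum_binSum hδ, sub_eq_zero]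
    -- If `N - s - 2 < 0`, the binomial coefficients do not match, but `y = a(s + 1) x` has negative
    -- degree `N - s - 2`.
    rcases lt_or_ge (N - s - 2 : ℤ) 0 with h | h
    · have : δ = fun _ => 0 := by
        funext q
        simp [δ, hy, YS_eq_zero ha hx (m := s + 1) (by omega)]
      simp [this, shiftSum]
    · obtain ⟨L, hL⟩ : ∃ L : ℕ, (N - s - 2 : ℤ) = L := ⟨(N - s - 2 : ℤ).toNat, by omega⟩
      rw [show (N + (-s - 2) : ℤ) = L by omega, binSum_delta_eq_altSum_delta L y (-2) n,
        show -2 - L - n = s - N - n by omega]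
      rfl

theorem YS_skew {k l d : ℤ} {a b : V} {x : S M} (ha : a ∈ A.gr k) (hb : b ∈ A.gr l)
    (hx : x ∈ grS M d) (s n : ℤ) :
    YS M (A.Y b n a) (s - n) x = -((-1 : ℂ) ^ n • shiftSum (Ring.choose (s - n))
      (fun n => YS M (A.Y a n b) (s - n) x) n) := by
  obtain ⟨B, hB⟩ := A.truncated a b
  have h1 : ∀ n, B ≤ n → YS M (A.Y a n b) (s - n) x = 0 := fun n hn => by
    rw [hB n hn, map_zero]; rfl
  have hT : B ≤ n + (B - n).toNat := by omega
  rw [shiftSum_eq_sum h1 _ hT, skew_symmetry A a b n,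
    finsum_eq_sum_of_support_subset (s := Finset.range (B - n).toNat)]
  · rw [map_neg, Pi.neg_apply, LinearMap.neg_apply, map_smul, Pi.smul_apply, LinearMap.smul_apply,
      map_sum, Finset.sum_apply, LinearMap.sum_apply]
    congr 2
    refine Finset.sum_congr rfl fun i _ => ?_
    rw [map_zsmul, Pi.smul_apply, LinearMap.smul_apply,
      YS_translation (A.homogeneous k l _ a b ha hb) hx, smul_smul, sub_sub]
    congr 1
    rw [altChoose, ← mul_assoc, show (-1 : ℤ) = -(1 : ℤ) by rfl, Ring.choose_neg,
      add_sub_cancel_left, Ring.choose_natCast, Nat.choose_self, Units.smul_def, Int.negOnePow_def]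
    simp [← mul_pow]
  · intro i hi
    by_contra h
    simp only [Finset.coe_range, Set.mem_Iio, not_lt] at h
    exact hi (by dsimp only; rw [hB _ (by omega)]; simp)

theorem jacobi_of_mem {k l d : ℤ} {a b : V} {x : S M} (ha : a ∈ A.gr k) (hb : b ∈ A.gr l)
    (hx : x ∈ grS M d) (s m n : ℤ) :
    shiftSum (Ring.choose m) (fun n => YS M (A.Y a n b) (s - n) x) n =
      shiftSum (altChoose n) (fun q => YS M a (s - q) (YS M b q x)) (s - m - n) -
      (-1 : ℂ) ^ n • shiftSum (altChoose n) (fun p => YS M b (s - p) (YS M a p x)) m := by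
  rcases eq_zero_or_weight_nonneg hb with rfl | hl
  · simp only [map_zero, Pi.zero_apply, LinearMap.zero_apply, shiftSum, smul_zero, finsum_zero]
    rw [show (-1 : ℂ) ^ n • (0 : S M) = 0 from smul_zero (M := ℂ) (A := S M) _, sub_zero]
  rcases eq_zero_or_degree_nonneg hx with rfl | hd
  · simp only [map_zero, shiftSum, smul_zero, finsum_zero]
    rw [show (-1 : ℂ) ^ n • (0 : S M) = 0 from smul_zero (M := ℂ) (A := S M) _, sub_zero]
  obtain ⟨N, hN⟩ : ∃ N : ℕ, l + d = N := ⟨(l + d).toNat, by omega⟩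
  obtain ⟨B₁, h₁⟩ := exists_bound a b s x
  obtain ⟨B₂, h₂⟩ := exists_bound b a s x
  refine jacobi_of_assoc (N := k + d) (N' := l + d) (fun q hq => ?_) (fun p hp => ?_) h₁
    (YS_assoc ha hb hx s) (fun n => ?_) m n
  · rw [YS_eq_zero hb hx hq, map_zero]
  · rw [YS_eq_zero ha hx hp, map_zero]
  · have h := binSum_swap (B := max B₁ B₂) (fun n hn => h₁ n (by omega))
      (fun n hn => h₂ n (by omega))
      (YS_skew ha hb hx s) N n
    rw [← hN, YS_assoc hb ha hx] at h
    rw [h, smul_neg, neg_neg, smul_smul, ← mul_zpow]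
    simp

end Module

/-! ### The grading of `S(M)` -/

section Grading

variable {V : Type u} [AddCommGroup V] [Module ℂ V] (A : NGradedVertexAlgebra V)

/-- The linear map that acts on `V_(k)` as `2 ^ k`. -/
noncomputable def weightScale : V →ₗ[ℂ] V :=
  DirectSum.toModule ℂ ℤ V (fun k => (2 : ℂ) ^ k • (A.gr k).subtype) ∘ₗ (decompose A).toLinearMap

theorem weightScale_of_mem {k : ℤ} {a : V} (ha : a ∈ A.gr k) :
    weightScale A a = (2 : ℂ) ^ k • a := by
  simp [weightScale, decompose_of_mem A ha]

/-- The substitution `t ↦ t / 2` on Laurent polynomials. -/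
noncomputable def laurentScale : LaurentPolynomial ℂ →ₐ[ℂ] LaurentPolynomial ℂ :=
  AddMonoidAlgebra.lift ℂ (LaurentPolynomial ℂ) ℤ
    { toFun := fun m => LaurentPolynomial.C ((2 : ℂ) ^ (-m.toAdd)) * LaurentPolynomial.T m.toAdd
      map_one' := by simp
      map_mul' := fun m n => by
        rw [toAdd_mul, neg_add, zpow_add₀ two_ne_zero, map_mul, LaurentPolynomial.T_add]
        ring }

theorem laurentScale_T (m : ℤ) :
    laurentScale (LaurentPolynomial.T m) = (2 : ℂ) ^ (-m) • LaurentPolynomial.T m := by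
  rw [laurentScale, LaurentPolynomial.T, AddMonoidAlgebra.lift_single, one_smul]
  exact (LaurentPolynomial.smul_eq_C_mul _ _).symm

/-- The endomorphism of the algebra `T(V[t, t⁻¹])` that acts as `2 ^ d` in degree `d`. -/
noncomputable def scaleT : TAff V →ₐ[ℂ] TAff V :=
  TensorAlgebra.lift ℂ ((2 : ℂ)⁻¹ • TensorAlgebra.ι ℂ ∘ₗ
    TensorProduct.map (weightScale A) laurentScale.toLinearMap)

theorem scaleT_gen {k : ℤ} {a : V} (ha : a ∈ A.gr k) (m : ℤ) :
    scaleT A (gen m a) = (2 : ℂ) ^ (k - m - 1) • gen m a := by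
  simp only [scaleT, gen, LinearMap.comp_apply, LinearMap.flip_apply, TensorProduct.mk_apply,
    TensorAlgebra.lift_ι_apply, LinearMap.smul_apply, TensorProduct.map_tmul,
    weightScale_of_mem A ha, AlgHom.toLinearMap_apply, laurentScale_T, TensorProduct.smul_tmul_smul,
    map_smul, smul_smul]
  congr 1
  rw [sub_sub, sub_eq_add_neg, zpow_add₀ two_ne_zero, neg_add, zpow_add₀ two_ne_zero, zpow_neg_one]
  ring

variable {A} (M : ZhuModuleCat.{u, w} A)

/-- The map on `T(V[t, t⁻¹]) ⊗ M` that acts as `2 ^ d` in degree `d`; it is semilinear with respect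
to `scaleT`. -/
noncomputable def scaleTM : TM M →ₛₗ[(scaleT A).toRingHom] TM M where
  toFun := TensorProduct.map (scaleT A).toLinearMap LinearMap.id
  map_add' := map_add _
  map_smul' t x := by
    induction x using TensorProduct.induction_on with
    | zero => simp only [smul_zero, map_zero]
    | tmul s y => simp [TensorProduct.smul_tmul']
    | add x y hx hy => rw [smul_add, map_add, hx, hy, map_add, smul_add]

theorem scaleTM_smul (c : ℂ) (x : TM M) : scaleTM M (c • x) = c • scaleTM M x :=
  map_smul (TensorProduct.map (scaleT A).toLinearMap (LinearMap.id (R := ℂ) (M := M.carrier))) c x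

theorem scaleTM_of_mem {d : ℤ} {x : TM M} (hx : x ∈ grTM M d) :
    scaleTM M x = (2 : ℂ) ^ d • x := by
  have key : ∀ {d : ℤ} {x : TM M}, IsMonomial M d x → scaleTM M x = (2 : ℂ) ^ d • x := by
    intro d x h
    induction h with
    | of y =>
      change TensorProduct.map (scaleT A).toLinearMap LinearMap.id (1 ⊗ₜ[ℂ] y) = _
      simp
    | act a ha m _ ih =>
      rw [map_smulₛₗ, ih]
      change scaleT A (gen m a) • _ = _
      rw [scaleT_gen A ha, smul_assoc, smul_comm (gen m a), smul_smul, ← zpow_add₀ two_ne_zero]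
  unfold grTM at hx
  induction hx using Submodule.span_induction with
  | mem x h => exact key h
  | zero => rw [map_zero, smul_zero]
  | add x y _ _ hx hy => rw [map_add, hx, hy, smul_add]
  | smul c x _ hx => rw [scaleTM_smul, hx, smul_comm]

variable {M} in
theorem gen_smul_mem {k d : ℤ} {a : V} (ha : a ∈ A.gr k) (m : ℤ) {x : TM M} (hx : x ∈ grTM M d)
    {e : ℤ} (he : e = k - m - 1 + d) : gen m a • x ∈ grTM M e :=
  he ▸ gen_smul_mem_grTM ha m hx

variable {M} in
theorem oT_smul_mem (a : V) (y : M.carrier) : oT A a • ((1 : TAff V) ⊗ₜ[ℂ] y) ∈ grTM M 0 := by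
  induction a using homogeneous_induction A.internal.submodule_iSup_eq_top with
  | hom k a ha =>
    rw [show oT A a = gen (k - 1) a by simp [oT, decompose_of_mem A ha]]
    exact gen_smul_mem ha _ (Submodule.subset_span (IsMonomial.of y)) (by ring)
  | add a b ha hb => rw [map_add, add_smul]; exact Submodule.add_mem _ ha hb

/-- The generators of `𝓘` are homogeneous. -/
theorem IGen.homogeneous {x : TM M} (h : IGen M x) : ∃ d, x ∈ grTM M d := by
  cases h with
  | neg m a x ha hx h => exact ⟨_, gen_smul_mem_grTM ha m hx⟩
  | zero a y =>
    exact ⟨0, Submodule.sub_mem _ (oT_smul_mem a y) (Submodule.subset_span (IsMonomial.of _))⟩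
  | prod p q a b x ha hb hx hq h =>
    refine ⟨_, Submodule.sub_mem _ (gen_smul_mem_grTM ha p (gen_smul_mem_grTM hb q hx)) ?_⟩
    rw [iterateSum, Finset.sum_smul]
    refine Submodule.sum_mem _ fun i _ => ?_
    rw [Finset.sum_smul]
    refine Submodule.sum_mem _ fun j _ => ?_
    rw [smul_assoc]
    exact zsmul_mem (gen_smul_mem (A.homogeneous _ _ _ a b ha hb) _ hx (by ring)) _

theorem subI_le_comap_scale : subI M ≤ (subI M).comap (scaleTM M) := by
  refine Submodule.span_le.2 fun x hx => ?_
  obtain ⟨d, hd⟩ := IGen.homogeneous M hx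
  change scaleTM M x ∈ subI M
  rw [scaleTM_of_mem M hd]
  exact Submodule.smul_of_tower_mem _ _ (Submodule.subset_span hx)

/-- The map induced by `scaleTM` on `S₁(M)`. -/
noncomputable def scaleS₁ : S₁ M →ₛₗ[(scaleT A).toRingHom] S₁ M :=
  Submodule.mapQ _ _ (scaleTM M) (subI_le_comap_scale M)

theorem scaleS₁_of_mem {d : ℤ} {x : S₁ M} (hx : x ∈ grS₁ M d) :
    scaleS₁ M x = (2 : ℂ) ^ d • x := by
  obtain ⟨y, hy, rfl⟩ := hx
  change (subI M).mkQ (scaleTM M y) = _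
  rw [scaleTM_of_mem M hy, LinearMap.map_smul_of_tower]
  rfl

variable {M} in
theorem gen_smul_mem_grS₁ {k d : ℤ} {a : V} (ha : a ∈ A.gr k) (m : ℤ) {x : S₁ M}
    (hx : x ∈ grS₁ M d) {e : ℤ} (he : e = k - m - 1 + d) : gen m a • x ∈ grS₁ M e := by
  obtain ⟨y, hy, rfl⟩ := hx
  exact ⟨_, gen_smul_mem ha m hy he, rfl⟩

/-- The generators of `𝓙` are homogeneous. -/
theorem JGen.homogeneous {x : S₁ M} (h : JGen M x) : ∃ d, x ∈ grS₁ M d := by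
  cases h with
  | @mk k l d K m a b x ha hb hx h =>
    refine ⟨d - K, ?_⟩
    rw [truncSum, Finset.sum_smul]
    refine Submodule.sum_mem _ fun j _ => ?_
    rw [smul_assoc]
    exact zsmul_mem (gen_smul_mem_grS₁ (A.homogeneous _ _ _ a b ha hb) _ hx (by ring)) _

theorem subJ_le_comap_scale : subJ M ≤ (subJ M).comap (scaleS₁ M) := by
  refine Submodule.span_le.2 fun x hx => ?_
  obtain ⟨d, hd⟩ := JGen.homogeneous M hx
  change scaleS₁ M x ∈ subJ M
  rw [scaleS₁_of_mem M hd]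
  exact Submodule.smul_of_tower_mem _ _ (Submodule.subset_span hx)

/-- The map induced by `scaleTM` on `S(M)`. -/
noncomputable def scaleS : Module.End ℂ (S M) where
  toFun := Submodule.mapQ _ _ (scaleS₁ M) (subJ_le_comap_scale M)
  map_add' := map_add _
  map_smul' c x := by
    rw [← algebraMap_smul (TAff V) c x, map_smulₛₗ]
    change scaleT A (algebraMap ℂ (TAff V) c) • _ = _
    rw [AlgHom.commutes, algebraMap_smul]
    rfl

theorem scaleS_of_mem {d : ℤ} {x : S M} (hx : x ∈ grS M d) : scaleS M x = (2 : ℂ) ^ d • x := by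
  obtain ⟨y, hy, rfl⟩ := hx
  change (subJ M).mkQ (scaleS₁ M y) = _
  rw [scaleS₁_of_mem M hy, LinearMap.map_smul_of_tower]
  rfl

theorem iSup_grTM : iSup (grTM M) = ⊤ := by
  rw [eq_top_iff]
  intro x _
  have hgen : ∀ (m : ℤ) (a : V) (x : TM M), x ∈ iSup (grTM M) → gen m a • x ∈ iSup (grTM M) := by
    intro m a x hx
    refine Submodule.iSup_induction _ (motive := fun x => gen m a • x ∈ iSup (grTM M)) hx
      (fun d x hx => ?_) (by rw [smul_zero]; exact Submodule.zero_mem _)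
      (fun x y hx hy => by rw [smul_add]; exact Submodule.add_mem _ hx hy)
    induction a using homogeneous_induction A.internal.submodule_iSup_eq_top with
    | hom k a ha => exact Submodule.mem_iSup_of_mem _ (gen_smul_mem_grTM ha m hx)
    | add a b ha hb => rw [map_add, add_smul]; exact Submodule.add_mem _ ha hb
  have hι : ∀ (v : V ⊗[ℂ] LaurentPolynomial ℂ) (x : TM M), x ∈ iSup (grTM M) →
      TensorAlgebra.ι ℂ v • x ∈ iSup (grTM M) := by
    intro v x hx
    induction v using TensorProduct.induction_on with
    | zero => rw [map_zero, zero_smul]; exact Submodule.zero_mem _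
    | tmul a p =>
      induction p using LaurentPolynomial.induction_on' with
      | add p q hp hq =>
        rw [TensorProduct.tmul_add, map_add, add_smul]
        exact Submodule.add_mem _ hp hq
      | C_mul_T m c =>
        rw [← LaurentPolynomial.smul_eq_C_mul, TensorProduct.tmul_smul, map_smul, smul_assoc]
        exact Submodule.smul_mem _ c (hgen m a x hx)
    | add v v' h h' => rw [map_add, add_smul]; exact Submodule.add_mem _ h h'
  have hT : ∀ (t : TAff V) (x : TM M), x ∈ iSup (grTM M) → t • x ∈ iSup (grTM M) := by
    intro t
    induction t using TensorAlgebra.induction with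
    | algebraMap c => intro x hx; rw [algebraMap_smul]; exact Submodule.smul_mem _ c hx
    | ι v => exact hι v
    | mul s t hs ht => intro x hx; rw [mul_smul]; exact hs _ (ht _ hx)
    | add s t hs ht => intro x hx; rw [add_smul]; exact Submodule.add_mem _ (hs _ hx) (ht _ hx)
  induction x using TensorProduct.induction_on with
  | zero => exact Submodule.zero_mem _
  | tmul t y =>
    have := hT t (1 ⊗ₜ y) (Submodule.mem_iSup_of_mem 0 (Submodule.subset_span (IsMonomial.of y)))
    rwa [TensorProduct.smul_tmul', smul_eq_mul, mul_one] at this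
  | add x y hx hy => exact Submodule.add_mem _ (hx trivial) (hy trivial)

theorem iSup_grS : iSup (grS M) = ⊤ := by
  simp only [show grS M = fun d => (grTM M d).map ((toS M).restrictScalars ℂ) from
    funext grS_eq_map, ← Submodule.map_iSup]
  rw [iSup_grTM, Submodule.map_top, LinearMap.range_eq_top]
  exact toS_surjective

/-- The grading of `S(M)` is direct: `S(M)_(d)` lies in the eigenspace of `scaleS` for `2 ^ d`. -/
theorem grS_isInternal : DirectSum.IsInternal (grS M) := by
  refine (DirectSum.isInternal_submodule_iff_iSupIndep_and_iSup_eq_top _).2 ⟨?_, iSup_grS M⟩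
  have h2 : Function.Injective fun d : ℤ => (2 : ℂ) ^ d := by
    intro d e h
    have h' : (2 : ℝ) ^ d = 2 ^ e := Complex.ofReal_injective (by push_cast; exact h)
    exact zpow_right_injective₀ two_pos (by norm_num) h'
  refine ((Module.End.eigenspaces_iSupIndep (scaleS M)).comp h2).mono fun d x hx => ?_
  exact Module.End.mem_eigenspace_iff.2 (scaleS_of_mem M hx)

end Grading

/-! ### The weak module `S(M)` and the functor -/

section Functor

variable {V : Type u} [AddCommGroup V] [Module ℂ V] {A : NGradedVertexAlgebra V}

theorem YS_truncated (M : ZhuModuleCat.{u, w} A) : LowerTruncated (YS M) := by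
  intro a x
  induction a using homogeneous_induction A.internal.submodule_iSup_eq_top with
  | hom k a ha =>
    induction x using homogeneous_induction (iSup_grS M) with
    | hom d x hx => exact ⟨k + d, fun n hn => YS_eq_zero ha hx hn⟩
    | add x y hx hy =>
      obtain ⟨N₁, h₁⟩ := hx
      obtain ⟨N₂, h₂⟩ := hy
      exact ⟨max N₁ N₂, fun n hn => by rw [map_add, h₁ n (by omega), h₂ n (by omega), add_zero]⟩
  | add a b ha hb =>
    obtain ⟨N₁, h₁⟩ := ha
    obtain ⟨N₂, h₂⟩ := hb
    refine ⟨max N₁ N₂, fun n hn => ?_⟩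
    rw [map_add, Pi.add_apply, LinearMap.add_apply, h₁ n (by omega), h₂ n (by omega), add_zero]

theorem YS_vacuum (M : ZhuModuleCat.{u, w} A) (n : ℤ) (x : S M) :
    YS M A.vac n x = if n = -1 then x else 0 := by
  induction x using homogeneous_induction (iSup_grS M) with
  | hom d x hx => exact YS_vac_of_mem hx n
  | add x y hx hy => rw [map_add, hx, hy]; split_ifs <;> simp

theorem finite_support_smul {W : Type*} [AddCommGroup W] {f : ℕ → W} {B : ℤ}
    (hf : ∀ i : ℕ, B ≤ i → f i = 0) (c : ℕ → ℤ) : (Function.support fun i => c i • f i).Finite := by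
  refine (Set.finite_lt_nat B.toNat).subset fun i hi => ?_
  by_contra h
  simp only [Set.mem_ofPred_eq, not_lt] at h
  exact hi (by dsimp only; rw [hf i (by omega), smul_zero])

/-- The Jacobi identity is additive in each of its three vectors, so it can be checked on
homogeneous ones. -/
theorem jacobiIdentity_of_homogeneous {W : Type*} [AddCommGroup W] [Module ℂ W]
    {YW : V →ₗ[ℂ] ℤ → Module.End ℂ W} (ht : LowerTruncated YW) {gr : ℤ → Submodule ℂ W}
    (hgr : iSup gr = ⊤)
    (h : ∀ (p q d : ℤ) (a b : V) (x : W), a ∈ A.gr p → b ∈ A.gr q → x ∈ gr d → ∀ s m n : ℤ,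
      shiftSum (Ring.choose m) (fun n => YW (A.Y a n b) (s - n) x) n =
        shiftSum (altChoose n) (fun q => YW a (s - q) (YW b q x)) (s - m - n) -
        (-1 : ℂ) ^ n • shiftSum (altChoose n) (fun p => YW b (s - p) (YW a p x)) m) :
    JacobiIdentity A.Y YW := by
  have hV := A.internal.submodule_iSup_eq_top
  intro a b x m n k
  have f₁ : ∀ a b x, (Function.support fun i : ℕ =>
      Ring.choose m i • YW (A.Y a (n + i) b) (m + k - i) x).Finite := fun a b x => by
    obtain ⟨B, hB⟩ := A.truncated a b
    refine finite_support_smul (B := B - n) (fun i hi => ?_) _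
    rw [hB _ (by omega), map_zero]
    rfl
  have f₂ : ∀ a b x, (Function.support fun i : ℕ => ((-1 : ℤ) ^ i * Ring.choose n i) •
      YW a (m + n - i) (YW b (k + i) x)).Finite := fun a b x => by
    obtain ⟨B, hB⟩ := ht b x
    refine finite_support_smul (B := B - k) (fun i hi => ?_) _
    rw [hB _ (by omega), map_zero]
  have f₃ : ∀ a b x, (Function.support fun i : ℕ => ((-1 : ℤ) ^ i * Ring.choose n i) •
      YW b (n + k - i) (YW a (m + i) x)).Finite := fun a b x => by
    obtain ⟨B, hB⟩ := ht a x
    refine finite_support_smul (B := B - m) (fun i hi => ?_) _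
    rw [hB _ (by omega), map_zero]
  have split : ∀ u v w u' v' w' : W, u = v - (-1 : ℂ) ^ n • w → u' = v' - (-1 : ℂ) ^ n • w' →
      u + u' = v + v' - (-1 : ℂ) ^ n • (w + w') := fun u v w u' v' w' h h' => by
    rw [h, h', smul_add]
    abel
  induction a using homogeneous_induction hV generalizing b x with
  | add a a' h h' =>
    simp only [map_add, Pi.add_apply, LinearMap.add_apply, smul_add]
    rw [finsum_add_distrib (f₁ _ _ _) (f₁ _ _ _), finsum_add_distrib (f₂ _ _ _) (f₂ _ _ _),
      finsum_add_distrib (f₃ _ _ _) (f₃ _ _ _)]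
    exact split _ _ _ _ _ _ (h b x) (h' b x)
  | hom p a ha =>
  induction b using homogeneous_induction hV generalizing x with
  | add b b' h h' =>
    simp only [map_add, Pi.add_apply, LinearMap.add_apply, smul_add]
    rw [finsum_add_distrib (f₁ _ _ _) (f₁ _ _ _), finsum_add_distrib (f₂ _ _ _) (f₂ _ _ _),
      finsum_add_distrib (f₃ _ _ _) (f₃ _ _ _)]
    exact split _ _ _ _ _ _ (h x) (h' x)
  | hom q b hb =>
  induction x using homogeneous_induction hgr with
  | add x x' h h' =>
    simp only [map_add, smul_add]
    rw [finsum_add_distrib (f₁ _ _ _) (f₁ _ _ _), finsum_add_distrib (f₂ _ _ _) (f₂ _ _ _),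
      finsum_add_distrib (f₃ _ _ _) (f₃ _ _ _)]
    exact split _ _ _ _ _ _ h h'
  | hom d x hx =>
    have h := h p q d a b x ha hb hx (m + n + k) m n
    rw [show m + n + k - m - n = k by ring] at h
    unfold shiftSum altChoose at h
    dsimp only at h
    convert h using 1
    · refine finsum_congr fun i => ?_
      rw [show m + n + k - (n + i) = m + k - i by ring]
    · congr 1
      · refine finsum_congr fun i => ?_
        rw [show m + n + k - (k + i) = m + n - i by ring]
      · congr 1
        refine finsum_congr fun i => ?_
        rw [show m + n + k - (m + i) = n + k - i by ring]

theorem isNGradableWeakModule_S (M : ZhuModuleCat.{u, w} A) :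
    IsNGradableWeakModule A (YS M) (grS M) where
  truncated := YS_truncated M
  vacuum := YS_vacuum M
  jacobi := jacobiIdentity_of_homogeneous (YS_truncated M) (iSup_grS M)
    fun _ _ _ _ _ _ ha hb hx => jacobi_of_mem ha hb hx
  internal := grS_isInternal M
  gr_neg _ hn := grS_neg hn
  homogeneous k l n a x ha hx := by
    rw [show l + k - n - 1 = k - n - 1 + l by ring]
    exact YS_mem_grS ha n hx

theorem mapS_toS {M₁ M₂ : ZhuModuleCat.{u, w} A} (f : M₁ ⟶ M₂) (x : TM M₁) :
    mapS f (toS M₁ x) = toS M₂ (mapTM f x) := rfl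

theorem mapS_isVertexMap {M₁ M₂ : ZhuModuleCat.{u, w} A} (f : M₁ ⟶ M₂) :
    IsVertexMap (YS M₁) (YS M₂) (mapS f) := by
  intro a n x
  obtain ⟨y, rfl⟩ := toS_surjective x
  rw [YS_toS, mapS_toS, mapS_toS, YS_toS, map_smul]

theorem mapTM_id (M : ZhuModuleCat.{u, w} A) (x : TM M) : mapTM (𝟙 M) x = x :=
  LinearMap.congr_fun (LinearMap.baseChange_id (A := TAff V) (R := ℂ) (M := M.carrier)) x

theorem mapTM_comp {M₁ M₂ M₃ : ZhuModuleCat.{u, w} A} (f : M₁ ⟶ M₂) (g : M₂ ⟶ M₃) (x : TM M₁) :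
    mapTM (f ≫ g) x = mapTM g (mapTM f x) :=
  LinearMap.congr_fun (LinearMap.baseChange_comp (A := TAff V)
    (ZhuModuleCat.Hom.toLin f) (ZhuModuleCat.Hom.toLin g)) x

theorem mapS_id (M : ZhuModuleCat.{u, w} A) : mapS (𝟙 M) = LinearMap.id := by
  refine LinearMap.ext fun x => ?_
  obtain ⟨y, rfl⟩ := toS_surjective x
  rw [mapS_toS, mapTM_id, LinearMap.id_apply]

theorem mapS_comp {M₁ M₂ M₃ : ZhuModuleCat.{u, w} A} (f : M₁ ⟶ M₂) (g : M₂ ⟶ M₃) :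
    mapS (f ≫ g) = mapS g ∘ₗ mapS f := by
  refine LinearMap.ext fun x => ?_
  obtain ⟨y, rfl⟩ := toS_surjective x
  rw [LinearMap.comp_apply, mapS_toS, mapS_toS, mapS_toS, mapTM_comp]

end Functor

end ZhuFunctor

theorem corollary4p2 {V : Type u} [AddCommGroup V] [Module ℂ V] (A : NGradedVertexAlgebra V) :
    ∃ (hobj : ∀ M : ZhuModuleCat.{u, w} A, IsNGradableWeakModule A (YS M) (grS M))
      (hmap : ∀ (M₁ M₂ : ZhuModuleCat.{u, w} A) (f : M₁ ⟶ M₂),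
        IsVertexMap (YS M₁) (YS M₂) (mapS f)),
      ∃ F : ZhuModuleCat.{u, w} A ⥤ WeakModuleCat.{u, max u w} A,
        F.toPrefunctor =
          { obj := fun M => ⟨S M, YS M, grS M, hobj M⟩
            map := fun {M₁ M₂} f => ⟨mapS f, hmap M₁ M₂ f⟩ } := by
  refine ⟨isNGradableWeakModule_S, fun _ _ => mapS_isVertexMap,
    { obj := fun M => ⟨S M, YS M, grS M, isNGradableWeakModule_S M⟩
      map := fun f => ⟨mapS f, mapS_isVertexMap f⟩
      map_id := fun M => WeakModuleCat.Hom.ext (mapS_id M)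
      map_comp := fun f g => WeakModuleCat.Hom.ext (mapS_comp f g) }, rfl⟩
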